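/- For real $p>1$ put $c(p)=p^p(p-1)^{1-p}$, so that $c(3)=27/4$. For real $r$ put $$\psi_{p,r}(\sigma)=\frac{\Gamma\big((\sigma-1)p+r+1\big)}{\Gamma(\sigma)\,\Gamma\big((\sigma-1)(p-1)+r+1\big)},$$ and on $(0,c(p))$ let $V_{p,r}$ be the inverse Mellin transform of $\psi_{p,r}$, $$V_{p,r}(x)=\frac1{2\pi\mathrm i}\int_{d-\mathrm i\infty}^{d+\mathrm i\infty}x^{-\sigma}\psi_{p,r}(\sigma)\,d\sigma ,\qquad d>1-\frac{1+r}{p},$$ understood as an improper (conditionally convergent) integral, whenever it exists. **Theorem.** Let $p=3$ and write $z=4x/27$. For every $x\in(0,27/4)$, every $r\in\{0,1,2\}$ and every $d>1-\frac{1+r}{3}$ the integral defining $V_{3,r}(x)$ converges, its value does not depend on $d$, and \begin{align*} V_{3,0}(x)&=\frac{\left(1+\sqrt{1-z}\right)^{1/3}}{9\pi\sqrt{3(1-z)}}z^{-2/3}+\frac{\left(1+\sqrt{1-z}\right)^{-1/3}}{9\pi\sqrt{3(1-z)}}z^{-1/3},\\ V_{3,1}(x)&=\frac{\left(1+\sqrt{1-z}\right)^{2/3}}{6\pi\sqrt{3(1-z)}}z^{-1/3}+\frac{\left(1+\sqrt{1-z}\right)^{-2/3}}{6\pi\sqrt{3(1-z)}}z^{1/3},\\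 V_{3,2}(x)&=\frac{\left(1+\sqrt{1-z}\right)^{1/3}}{4\pi\sqrt{3(1-z)}}z^{1/3}+\frac{\left(1+\sqrt{1-z}\right)^{-1/3}}{4\pi\sqrt{3(1-z)}}z^{2/3}. \end{align*} Moreover, for $r\in\{0,1,2\}$ there is exactly one probability measure $\nu(3,r)$ on $\mathbb R$ whose $n$-th moment is $\binom{3n+r}{n}$ for all $n\ge0$, and $\nu(3,r)=V_{3,r}(x)\,dx$ on $(0,27/4)$. -/

import Mathlib

open Set Filter Topology MeasureTheory

noncomputable section

/-- The right end point `c(p) = p ^ p (p - 1) ^ (1 - p)` of the support (for `p > 1`). -/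
def cEnd (p : ℝ) : ℝ := p ^ p * (p - 1) ^ (1 - p)

/-- `ψ_{p,r}(σ) = Γ((σ - 1) p + r + 1) / (Γ(σ) Γ((σ - 1)(p - 1) + r + 1))`. Below it is only
evaluated at `Re σ > 1 - (1 + r) / p`, where the numerator has no pole. At a pole of the
denominator Mathlib's `Complex.Gamma` takes the value `0`, and dividing by `0` gives `0`, which is
the value of the entire function `1 / Γ` there, so no limit has to be taken. -/
def psi (p r : ℝ) (σ : ℂ) : ℂ :=
  Complex.Gamma ((σ - 1) * p + r + 1) /
    (Complex.Gamma σ * Complex.Gamma ((σ - 1) * (p - 1) + r + 1))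

/-- The improper integral `(1 / (2 π i)) ∫_{d - i∞}^{d + i∞} x ^ (-σ) F(σ) dσ` converges, with
value `v`. The integral is over the line `σ = d + i t`, and the two ends go to infinity
independently of each other; convergence need not be absolute. -/
def HasInverseMellinAt (F : ℂ → ℂ) (d x : ℝ) (v : ℂ) : Prop :=
  (∀ a b : ℝ, IntervalIntegrable
    (fun t : ℝ => (x : ℂ) ^ (-((d : ℂ) + t * Complex.I)) * F ((d : ℂ) + t * Complex.I))
    volume a b) ∧
  Tendsto
    (fun I : ℝ × ℝ => (1 / (2 * (Real.pi : ℂ))) *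
      ∫ t in I.1..I.2, (x : ℂ) ^ (-((d : ℂ) + t * Complex.I)) * F ((d : ℂ) + t * Complex.I))
    (atBot ×ˢ atTop) (𝓝 v)

/-- `V` is, on `(0, c(p))`, the inverse Mellin transform of `ψ_{p,r}`, taken along any vertical
line in the half-plane `Re σ > 1 - (1 + r) / p`. -/
def IsInverseMellinOfPsi (p r : ℝ) (V : ℝ → ℝ) : Prop :=
  ∀ x ∈ Ioo 0 (cEnd p), ∀ d : ℝ, 1 - (1 + r) / p < d →
    HasInverseMellinAt (psi p r) d x (V x : ℂ)

/-- `ν` is a probability measure on the real line whose `n`-th moment exists and equals the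
(generalized) binomial coefficient `binom (n p + r) n`, for every `n`. -/
def HasBinomialMoments (p r : ℝ) (ν : Measure ℝ) : Prop :=
  IsProbabilityMeasure ν ∧
    ∀ n : ℕ, Integrable (fun x : ℝ => x ^ n) ν ∧
      ∫ x, x ^ n ∂ν = Ring.choose ((n : ℝ) * p + r) n

/-- There is exactly one probability measure `ν(p, r)` with moments `binom (n p + r) n`, it is
absolutely continuous, it is concentrated on `(0, c(p))`, and `V` is its density there. -/
def IsDensityOfNu (p r : ℝ) (V : ℝ → ℝ) : Prop :=
  (∀ x ∈ Ioo 0 (cEnd p), 0 ≤ V x) ∧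
  AEMeasurable V (volume.restrict (Ioo 0 (cEnd p))) ∧
  ∃ ν : Measure ℝ, HasBinomialMoments p r ν ∧
    (∀ ν' : Measure ℝ, HasBinomialMoments p r ν' → ν' = ν) ∧
    ν = (volume.restrict (Ioo 0 (cEnd p))).withDensity (fun x => ENNReal.ofReal (V x))

/-- `V` is the function `V_{p,r}` on `(0, c(p))`: the inverse Mellin transform of `ψ_{p,r}` and the
density of `ν(p, r)`. -/
def IsV (p r : ℝ) (V : ℝ → ℝ) : Prop :=
  IsInverseMellinOfPsi p r V ∧ IsDensityOfNu p r V

end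

/-!
The three functions have one shape: with `z = 4 x / 27` and `s = √(1 - z)`, each is
`((1 + s) ^ A + (1 - s) ^ A) z ^ B / (k π √3 s)`, because `(1 + s) (1 - s) = z`. The substitution
`x = 27 v (1 - v)`, for which `s = 1 - 2 v` on `(0, 1/2)`, turns the Mellin transform of such a
function into a complete Beta integral: the two summands are the two halves of it, exchanged by
`v ↦ 1 - v` (`hasMellin_densityExt`). Gauss's triplication formula for the Gamma function
(`Gamma_mul_Gamma_add_third_mul_Gamma_add_two_thirds`, derived from Euler's limit formula)
identifies the result with `ψ_{3,r}` (`hasMellin_densityExt_psi`).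

Since `ψ_{3,r}` decays only like `|t| ^ (-1/2)` on vertical lines, the inverse Mellin integral is
not absolutely convergent. In the variable `u = -log x` it is a Fourier inversion integral for an
integrable function that is differentiable at the point in question. The Dini-type argument
`tendsto_integral_fourier_zero` gives its convergence, with both ends independent, and its value.

At `σ = n + 1` the Mellin transform is the `n`-th moment and `ψ_{3,r}` is the binomial
coefficient, so the function is the density of a probability measure with the required moments.
The moments are at most `2 ^ r 8 ^ n`, so the characteristic function of any measure having them is
the sum of its Taylor series, which gives uniqueness (`measure_eq_of_moments`).
-/

/-! ### Pointwise Fourier and Mellin inversion -/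

open scoped FourierTransform

/-- The Dini condition at a zero where the function is differentiable. -/
theorem integrable_inv_smul_of_differentiableAt_zero {h : ℝ → ℂ} (hi : Integrable h)
    (hd : DifferentiableAt ℝ h 0) (h0 : h 0 = 0) : Integrable (fun u : ℝ => u⁻¹ • h u) := by
  have hO := hd.isBigO_sub
  simp only [h0, sub_zero] at hO
  obtain ⟨C, hC⟩ := hO.bound
  obtain ⟨δ, hδ, hball⟩ := Metric.eventually_nhds_iff_ball.1 hC
  have hC0 : Integrable ((Metric.ball (0 : ℝ) δ).indicator (fun _ => C)) :=
    (integrable_indicator_iff measurableSet_ball).2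
      (integrableOn_const measure_ball_lt_top.ne)
  -- Dominated by `‖h u‖ / δ` off the ball of radius `δ`, and by the linear bound `C` inside it.
  refine Integrable.mono' ((hi.norm.const_mul δ⁻¹).add hC0.norm)
    (measurable_inv.aestronglyMeasurable.smul hi.aestronglyMeasurable) (ae_of_all _ fun u => ?_)
  rw [norm_smul, norm_inv, Pi.add_apply]
  by_cases hu : u ∈ Metric.ball (0 : ℝ) δ
  · have h1 := hball u hu
    rw [indicator_of_mem hu]
    have h2 : ‖u‖⁻¹ * ‖h u‖ ≤ ‖C‖ := by
      rcases eq_or_ne u 0 with rfl | hne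
      · simp
      · rw [inv_mul_le_iff₀ (norm_pos_iff.2 hne), mul_comm]
        exact h1.trans (mul_le_mul_of_nonneg_right (le_abs_self C) (norm_nonneg _))
    have : 0 ≤ δ⁻¹ * ‖h u‖ := by positivity
    linarith
  · have h1 : δ ≤ ‖u‖ := by simpa using hu
    have : ‖u‖⁻¹ * ‖h u‖ ≤ δ⁻¹ * ‖h u‖ := by gcongr
    rw [indicator_of_notMem hu]
    simpa using this

theorem continuous_fourier_of_integrable {h : ℝ → ℂ} (hi : Integrable h) : Continuous (𝓕 h) :=
  VectorFourier.fourierIntegral_continuous Real.continuous_fourierChar (by fun_prop) hi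

/-- If `h 0 = 0`, write `h u = u • q u` with `q` integrable. Then `𝓕 h` is, up to a constant, the
derivative of `𝓕 q`, so its integral over `[a, b]` is a difference of two values of `𝓕 q`, each of
which vanishes at infinity by the Riemann-Lebesgue lemma. In particular the two ends may go to
infinity independently. -/
theorem tendsto_integral_fourier_of_eq_zero {h : ℝ → ℂ} (hi : Integrable h)
    (hd : DifferentiableAt ℝ h 0) (h0 : h 0 = 0) :
    Tendsto (fun I : ℝ × ℝ => ∫ ξ in I.1..I.2, 𝓕 h ξ) (atBot ×ˢ atTop) (𝓝 0) := by
  set q : ℝ → ℂ := fun u => u⁻¹ • h u with hq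
  have hqi : Integrable q := integrable_inv_smul_of_differentiableAt_zero hi hd h0
  have hmul : (fun u : ℝ => u • q u) = h := by
    funext u
    rcases eq_or_ne u 0 with rfl | hne
    · simp [h0]
    · simp [hq, hne]
  set c : ℂ := -2 * Real.pi * Complex.I with hc
  have hc0 : c ≠ 0 := by simp [hc, Real.pi_ne_zero]
  have hder : ∀ ξ : ℝ, HasDerivAt (𝓕 q) (c • 𝓕 h ξ) ξ := by
    intro ξ
    have := Real.hasDerivAt_fourier hqi (by rw [hmul]; exact hi) ξ
    have e : (fun x : ℝ => (-2 * Real.pi * Complex.I * x) • q x) = c • h := by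
      funext u
      rw [← hmul]
      simp [hc, mul_assoc]
    have e' : 𝓕 (c • h) ξ = c • 𝓕 h ξ := by
      rw [Real.fourier_eq, Real.fourier_eq, ← integral_smul]
      congr 1
      funext v
      rw [Pi.smul_apply, smul_comm]
    rwa [e, e'] at this
  have hint : ∀ a b : ℝ, ∫ ξ in a..b, 𝓕 h ξ = c⁻¹ * (𝓕 q b - 𝓕 q a) := by
    intro a b
    have := intervalIntegral.integral_eq_sub_of_hasDerivAt (fun ξ _ => hder ξ)
      ((continuous_fourier_of_integrable hi).const_smul c |>.intervalIntegrable a b)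
    rw [← this, intervalIntegral.integral_smul, smul_eq_mul, inv_mul_cancel_left₀ hc0]
  simp only [hint]
  have hRL := Real.zero_at_infty_fourier q
  have h1 : Tendsto (fun I : ℝ × ℝ => 𝓕 q I.1) (atBot ×ˢ atTop) (𝓝 0) :=
    (hRL.mono_left atBot_le_cocompact).comp tendsto_fst
  have h2 : Tendsto (fun I : ℝ × ℝ => 𝓕 q I.2) (atBot ×ˢ atTop) (𝓝 0) :=
    (hRL.mono_left atTop_le_cocompact).comp tendsto_snd
  simpa using (h2.sub h1).const_mul c⁻¹

/-- Pointwise Fourier inversion at `0` for an integrable function differentiable there, with `𝓕 g`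
not assumed integrable. -/
theorem tendsto_integral_fourier_zero {g : ℝ → ℂ} (hi : Integrable g)
    (hd : DifferentiableAt ℝ g 0) :
    Tendsto (fun I : ℝ × ℝ => ∫ ξ in I.1..I.2, 𝓕 g ξ) (atBot ×ˢ atTop) (𝓝 (g 0)) := by
  set φ : ℝ → ℂ := fun x => Complex.exp (-Real.pi * (1 : ℂ) * (x : ℂ) ^ 2) with hφ
  have hφF : 𝓕 φ = φ := by
    simpa [hφ] using fourier_gaussian_pi (b := 1) (by simp)
  have hpi : 0 < (((Real.pi : ℂ) * 1)).re := by simpa using Real.pi_pos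
  have hφi : Integrable φ := by
    have := integrable_cexp_neg_mul_sq hpi
    simpa [hφ] using this
  have hφ1 : ∫ x, φ x = 1 := by
    have := integral_gaussian_complex hpi
    simp only [mul_one] at this
    rw [div_self (by simp [Real.pi_ne_zero])] at this
    simpa [hφ] using this
  have hφd : DifferentiableAt ℝ φ 0 := by
    have : DifferentiableAt ℝ (fun x : ℝ => (x : ℂ)) 0 := Complex.ofRealCLM.differentiableAt
    exact ((this.pow 2).const_mul _).cexp
  have hlim : Tendsto (fun I : ℝ × ℝ => ∫ ξ in I.1..I.2, 𝓕 φ ξ) (atBot ×ˢ atTop) (𝓝 1) := by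
    rw [hφF, ← hφ1]
    exact intervalIntegral_tendsto_integral hφi tendsto_fst tendsto_snd
  -- Subtracting a multiple of the Gaussian, whose own inversion is absolutely convergent, makes
  -- the value at `0` vanish.
  have h0 := tendsto_integral_fourier_of_eq_zero (h := g - g 0 • φ) (hi.sub (hφi.smul _))
    (hd.sub (hφd.const_smul _)) (by simp [hφ])
  have hF : 𝓕 (g - g 0 • φ) = 𝓕 g - g 0 • 𝓕 φ := by
    funext ξ
    have := Real.fourierIntegral_convergent_iff (f := g) ξ |>.2 hi
    have h2 := Real.fourierIntegral_convergent_iff (f := φ) ξ |>.2 hφi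
    simp only [Real.fourier_eq, Pi.sub_apply, Pi.smul_apply, smul_sub, smul_comm _ (g 0)]
    have h3 : Integrable fun v => g 0 • (Real.fourierChar (-inner ℝ v ξ) • φ v) := h2.smul (g 0)
    rw [integral_sub this h3, integral_smul]
  have h1 := h0.add (hlim.const_mul (g 0))
  simp only [zero_add, mul_one] at h1
  refine h1.congr fun I => ?_
  rw [hF]
  simp only [Pi.sub_apply, Pi.smul_apply]
  have hc : Continuous fun ξ => g 0 • 𝓕 φ ξ :=
    (continuous_fourier_of_integrable hφi).const_smul (g 0)
  rw [intervalIntegral.integral_sub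
    ((continuous_fourier_of_integrable hi).intervalIntegrable _ _) (hc.intervalIntegrable _ _),
    intervalIntegral.integral_smul]
  simp

theorem fourier_comp_add_right_apply (g : ℝ → ℂ) (u₀ ξ : ℝ) :
    𝓕 (fun u => g (u + u₀)) ξ = Complex.exp (2 * Real.pi * ξ * u₀ * Complex.I) * 𝓕 g ξ := by
  simp only [Real.fourier_eq']
  rw [← integral_add_right_eq_self _ (-u₀), ← integral_const_mul]
  congr 1
  funext u
  simp only [neg_add_cancel_right, smul_eq_mul]
  rw [← mul_assoc, ← Complex.exp_add]
  congr 2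
  simp
  ring

/-- The substitution `x = exp (-u)`, which turns a Mellin transform into a Fourier transform. -/
theorem integrable_exp_smul_of_mellinConvergent {f : ℝ → ℂ} {d : ℝ} (hf : MellinConvergent f d) :
    Integrable (fun u : ℝ => Real.exp (-d * u) • f (Real.exp (-u))) := by
  rw [MellinConvergent] at hf
  have himg : (fun u : ℝ => Real.exp (-u)) '' univ = Ioi 0 := by
    rw [image_univ]
    exact (neg_surjective.range_comp Real.exp).trans Real.range_exp
  have hder : ∀ u ∈ (univ : Set ℝ),
      HasDerivWithinAt (fun u : ℝ => Real.exp (-u)) (-Real.exp (-u)) univ u := fun u _ => by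
    simpa only [mul_neg, mul_one] using (hasDerivAt_neg u).exp.hasDerivWithinAt
  rw [← himg, integrableOn_image_iff_integrableOn_abs_deriv_smul MeasurableSet.univ hder
    ((Real.exp_injective.comp neg_injective).injOn), integrableOn_univ] at hf
  refine hf.congr (ae_of_all _ fun u => ?_)
  simp only [abs_neg, abs_of_pos (Real.exp_pos _), Complex.real_smul, smul_eq_mul]
  rw [← mul_assoc]
  congr 1
  rw [Complex.cpow_def_of_ne_zero (by simp),
    ← Complex.ofReal_log (Real.exp_pos _).le, Real.log_exp]
  push_cast
  rw [← Complex.exp_add]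
  congr 1
  ring

/-- Mellin inversion at a point of differentiability, as a conditionally convergent integral. -/
theorem hasInverseMellinAt_mellin {f : ℝ → ℂ} {d x : ℝ} (hx : 0 < x)
    (hf : MellinConvergent f d) (hfx : DifferentiableAt ℝ f x) :
    HasInverseMellinAt (mellin f) d x (f x) := by
  set g : ℝ → ℂ := fun u => Real.exp (-d * u) • f (Real.exp (-u)) with hg
  set u₀ : ℝ := -Real.log x with hu₀
  set G : ℝ → ℂ := fun u => g (u + u₀) with hG
  -- Translating by `u₀ = -log x` moves the point of inversion to `0`.
  have hGi : Integrable G := (integrable_exp_smul_of_mellinConvergent hf).comp_add_right u₀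
  have hGd : DifferentiableAt ℝ G 0 := by
    have hx' : Real.exp (-(0 + u₀)) = x := by simp [hu₀, Real.exp_log hx]
    have hf' : DifferentiableAt ℝ f (Real.exp (-(0 + u₀))) := by rwa [hx']
    have h1 : DifferentiableAt ℝ (fun u : ℝ => Real.exp (-(u + u₀))) 0 := by fun_prop
    have h2 : DifferentiableAt ℝ (fun u : ℝ => Real.exp (-d * (u + u₀))) 0 := by fun_prop
    exact h2.smul (DifferentiableAt.comp (0 : ℝ) hf' h1)
  have hpi : (Real.pi : ℂ) ≠ 0 := Complex.ofReal_ne_zero.2 Real.pi_ne_zero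
  have hxC : (x : ℂ) ≠ 0 := Complex.ofReal_ne_zero.2 hx.ne'
  have hxd : (x : ℂ) ^ (-(d : ℂ)) = Complex.exp (d * u₀) := by
    rw [Complex.cpow_def_of_ne_zero hxC, ← Complex.ofReal_log hx.le, hu₀]
    push_cast
    ring_nf
  have hline : ∀ t : ℝ, (x : ℂ) ^ (-((d : ℂ) + t * Complex.I)) *
      mellin f ((d : ℂ) + t * Complex.I) = (x : ℂ) ^ (-(d : ℂ)) * 𝓕 G (t / (2 * Real.pi)) := by
    intro t
    rw [mellin_eq_fourier, hG, fourier_comp_add_right_apply, ← mul_assoc, hxd]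
    have hre : ((d : ℂ) + t * Complex.I).re = d := by simp
    have him : ((d : ℂ) + t * Complex.I).im = t := by simp
    rw [hre, him]
    congr 1
    rw [Complex.cpow_def_of_ne_zero hxC, ← Complex.ofReal_log hx.le, ← Complex.exp_add, hu₀]
    congr 1
    push_cast
    field_simp
    ring
  have hcont : Continuous fun t : ℝ => (x : ℂ) ^ (-(d : ℂ)) * 𝓕 G (t / (2 * Real.pi)) :=
    continuous_const.mul ((continuous_fourier_of_integrable hGi).comp (by fun_prop))
  simp only [HasInverseMellinAt, hline]
  refine ⟨fun a b => hcont.intervalIntegrable a b, ?_⟩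
  have hdiv : Tendsto (fun I : ℝ × ℝ => (I.1 / (2 * Real.pi), I.2 / (2 * Real.pi)))
      (atBot ×ˢ atTop) (atBot ×ˢ atTop) :=
    (tendsto_id.atBot_div_const (by positivity)).prodMap
      (tendsto_id.atTop_div_const (by positivity))
  have hlim := ((tendsto_integral_fourier_zero hGi hGd).comp hdiv).const_mul
    ((x : ℂ) ^ (-(d : ℂ)))
  have hval : (x : ℂ) ^ (-(d : ℂ)) * G 0 = f x := by
    rw [hxd]
    simp only [hG, hg, zero_add, Complex.real_smul, hu₀, neg_neg, Real.exp_log hx]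
    push_cast
    rw [← mul_assoc, ← Complex.exp_add]
    simp
  rw [hval] at hlim
  refine hlim.congr fun I => ?_
  rw [intervalIntegral.integral_const_mul,
    intervalIntegral.integral_comp_div (fun t => 𝓕 G t) (by positivity)]
  simp only [Function.comp_apply, Complex.real_smul]
  push_cast
  field_simp

/-! ### Gauss's triplication formula -/

theorem prod_range_three_mul (f : ℕ → ℂ) (m : ℕ) :
    ∏ j ∈ Finset.range (3 * m), f j =
      ∏ k ∈ Finset.range m, f (3 * k) * f (3 * k + 1) * f (3 * k + 2) := by
  induction m with
  | zero => simp
  | succ m ih =>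
    rw [show 3 * (m + 1) = 3 * m + 1 + 1 + 1 by ring, Finset.prod_range_succ,
      Finset.prod_range_succ, Finset.prod_range_succ, ih, Finset.prod_range_succ]
    ring

theorem prod_range_add_ne_zero {s : ℂ} (hs : 0 < s.re) (m : ℕ) :
    ∏ j ∈ Finset.range m, (s + j) ≠ 0 := by
  refine Finset.prod_ne_zero_iff.2 fun j _ h => ?_
  have := congrArg Complex.re h
  simp only [Complex.add_re, Complex.natCast_re, Complex.zero_re] at this
  have hj : (0 : ℝ) ≤ j := j.cast_nonneg
  linarith

theorem prod_range_three_mul_add (s : ℂ) (m : ℕ) :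
    ∏ j ∈ Finset.range (3 * m), (3 * s + j) =
      27 ^ m * ((∏ j ∈ Finset.range m, (s + j)) * (∏ j ∈ Finset.range m, (s + 1 / 3 + j)) *
        ∏ j ∈ Finset.range m, (s + 2 / 3 + j)) := by
  rw [prod_range_three_mul, ← Finset.prod_mul_distrib, ← Finset.prod_mul_distrib,
    show (27 : ℂ) ^ m = ∏ _k ∈ Finset.range m, 27 by simp, ← Finset.prod_mul_distrib]
  refine Finset.prod_congr rfl fun k _ => ?_
  push_cast
  ring

/-- Gauss's triplication formula at the level of Euler's products: the denominators agree factor by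
factor, and apart from `(n / (3n + 2)) ^ (3s)` what remains does not depend on `s`. -/
theorem GammaSeq_mul_GammaSeq_mul_GammaSeq {s : ℂ} (hs : 0 < s.re) {n : ℕ} (hn : n ≠ 0) :
    Complex.GammaSeq s n * Complex.GammaSeq (s + 1 / 3) n * Complex.GammaSeq (s + 2 / 3) n =
      (((n / (3 * n + 2 : ℕ) : ℝ) : ℂ) ^ (3 * s) * Complex.GammaSeq (3 * s) (3 * n + 2)) *
        (27 ^ (n + 1) * n * (n.factorial : ℂ) ^ 3 / (3 * n + 2).factorial) := by
  have hnC : (n : ℂ) ≠ 0 := by exact_mod_cast hn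
  have h1 := prod_range_add_ne_zero hs (n + 1)
  have h2 := prod_range_add_ne_zero (s := s + 1 / 3) (by simp; positivity) (n + 1)
  have h3 := prod_range_add_ne_zero (s := s + 2 / 3) (by simp; positivity) (n + 1)
  have hf : ((3 * n + 2).factorial : ℂ) ≠ 0 := by exact_mod_cast Nat.factorial_ne_zero _
  have hpow : (n : ℂ) ^ s * (n : ℂ) ^ (s + 1 / 3) * (n : ℂ) ^ (s + 2 / 3) =
      ((n / (3 * n + 2 : ℕ) : ℝ) : ℂ) ^ (3 * s) * ((3 * n + 2 : ℕ) : ℂ) ^ (3 * s) * n := by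
    have hdiv : ((n / (3 * n + 2 : ℕ) : ℝ) : ℂ) ^ (3 * s) * ((3 * n + 2 : ℕ) : ℂ) ^ (3 * s) =
        (n : ℂ) ^ (3 * s) := by
      rw [← Complex.ofReal_natCast (3 * n + 2),
        ← Complex.mul_cpow_ofReal_nonneg (by positivity) (by positivity), ← Complex.ofReal_mul,
        div_mul_cancel₀ _ (by positivity), Complex.ofReal_natCast]
    rw [hdiv, ← Complex.cpow_add _ _ hnC, ← Complex.cpow_add _ _ hnC]
    nth_rewrite 3 [← Complex.cpow_one (n : ℂ)]
    rw [← Complex.cpow_add _ _ hnC]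
    congr 1
    ring
  unfold Complex.GammaSeq
  rw [show 3 * n + 2 + 1 = 3 * (n + 1) by ring, prod_range_three_mul_add]
  calc _ = ((n : ℂ) ^ s * (n : ℂ) ^ (s + 1 / 3) * (n : ℂ) ^ (s + 2 / 3)) *
        ((n.factorial : ℂ) ^ 3) / ((∏ j ∈ Finset.range (n + 1), (s + j)) *
        (∏ j ∈ Finset.range (n + 1), (s + 1 / 3 + j)) *
        ∏ j ∈ Finset.range (n + 1), (s + 2 / 3 + j)) := by
        field_simp
    _ = _ := by
        rw [hpow]
        field_simp

theorem Gamma_ne_zero_of_three_mul {s : ℂ} (hs : 0 < s.re) : Complex.Gamma (3 * s) ≠ 0 :=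
  Complex.Gamma_ne_zero_of_re_pos (by simpa using hs)

/-- The sequence on the left does not involve `s`, hence neither does the limit. -/
theorem tendsto_triplication_constant {s : ℂ} (hs : 0 < s.re) :
    Tendsto (fun n : ℕ => (27 ^ (n + 1) * n * (n.factorial : ℂ) ^ 3 / (3 * n + 2).factorial : ℂ))
      atTop (𝓝 (Complex.Gamma s * Complex.Gamma (s + 1 / 3) * Complex.Gamma (s + 2 / 3) /
        ((1 / 3 : ℂ) ^ (3 * s) * Complex.Gamma (3 * s)))) := by
  have hsub : Tendsto (fun n : ℕ => 3 * n + 2) atTop atTop :=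
    tendsto_atTop_mono (fun n => by simp only [id]; omega) tendsto_id
  have hq : Tendsto (fun n : ℕ => ((n / (3 * n + 2 : ℕ) : ℝ) : ℂ)) atTop (𝓝 ((1 / 3 : ℝ) : ℂ)) := by
    refine (Complex.continuous_ofReal.tendsto _).comp ?_
    have h := (tendsto_natCast_div_add_atTop (2 / 3 : ℝ)).const_mul (1 / 3)
    rw [mul_one] at h
    refine h.congr fun n => ?_
    push_cast
    have : (n : ℝ) + 2 / 3 ≠ 0 := by positivity
    field_simp
  have hpow : Tendsto (fun n : ℕ => ((n / (3 * n + 2 : ℕ) : ℝ) : ℂ) ^ (3 * s)) atTop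
      (𝓝 ((1 / 3 : ℂ) ^ (3 * s))) := by
    have := Filter.Tendsto.cpow hq (tendsto_const_nhds (x := 3 * s))
      (Complex.ofReal_mem_slitPlane.2 (by norm_num))
    simpa using this
  have hden := hpow.mul ((Complex.GammaSeq_tendsto_Gamma (3 * s)).comp hsub)
  have hnum := ((Complex.GammaSeq_tendsto_Gamma s).mul
    (Complex.GammaSeq_tendsto_Gamma (s + 1 / 3))).mul
    (Complex.GammaSeq_tendsto_Gamma (s + 2 / 3))
  have hne : (1 / 3 : ℂ) ^ (3 * s) * Complex.Gamma (3 * s) ≠ 0 :=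
    mul_ne_zero (by simp [Complex.cpow_eq_zero_iff]) (Gamma_ne_zero_of_three_mul hs)
  refine (hnum.div hden hne).congr' ?_
  filter_upwards [eventually_ne_atTop 0, hden.eventually_ne hne] with n hn hn'
  rw [Function.comp_apply] at hn'
  rw [Pi.div_apply, GammaSeq_mul_GammaSeq_mul_GammaSeq hs hn, Function.comp_apply,
    mul_div_cancel_left₀ _ hn']

theorem Gamma_one_third_mul_Gamma_two_thirds :
    Complex.Gamma (1 / 3) * Complex.Gamma (2 / 3) = 2 * Real.pi / (√3 : ℝ) := by
  have h := Complex.Gamma_mul_Gamma_one_sub (1 / 3)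
  rw [show (1 : ℂ) - 1 / 3 = 2 / 3 by norm_num] at h
  rw [h, show (Real.pi : ℂ) * (1 / 3) = ((Real.pi / 3 : ℝ) : ℂ) by push_cast; ring,
    ← Complex.ofReal_sin, Real.sin_pi_div_three]
  push_cast
  have : ((√3 : ℝ) : ℂ) ≠ 0 := by simp
  field_simp

/-- Gauss's triplication formula; the constant comes from the case `s = 1 / 3`. -/
theorem Gamma_mul_Gamma_add_third_mul_Gamma_add_two_thirds {s : ℂ} (hs : 0 < s.re) :
    Complex.Gamma s * Complex.Gamma (s + 1 / 3) * Complex.Gamma (s + 2 / 3) =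
      2 * Real.pi * (√3 : ℝ) * (27 : ℂ) ^ (-s) * Complex.Gamma (3 * s) := by
  have h := tendsto_nhds_unique (tendsto_triplication_constant hs)
    (tendsto_triplication_constant (s := 1 / 3) (by norm_num))
  have h3 : (1 / 3 : ℂ) ^ (3 * s) = 27 ^ (-s) := by
    have e : (1 / 3 : ℂ) = ((1 / 3 : ℝ) : ℂ) := by norm_num
    have e' : (27 : ℂ) = ((27 : ℝ) : ℂ) := by norm_num
    rw [e, e', Complex.cpow_def_of_ne_zero (by simp), Complex.cpow_def_of_ne_zero (by simp),
      ← Complex.ofReal_log (by norm_num), ← Complex.ofReal_log (by norm_num),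
      one_div, Real.log_inv, show (27 : ℝ) = 3 ^ 3 by norm_num, Real.log_pow]
    push_cast
    ring_nf
  have hne : (1 / 3 : ℂ) ^ (3 * s) * Complex.Gamma (3 * s) ≠ 0 :=
    mul_ne_zero (by simp [Complex.cpow_eq_zero_iff]) (Gamma_ne_zero_of_three_mul hs)
  rw [div_eq_iff hne, show (1 / 3 + 1 / 3 : ℂ) = 2 / 3 by norm_num,
    show (1 / 3 + 2 / 3 : ℂ) = 1 by norm_num, show (3 * (1 / 3) : ℂ) = 1 by norm_num,
    Complex.Gamma_one, Complex.cpow_one, Gamma_one_third_mul_Gamma_two_thirds, h3] at h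
  rw [h]
  have hsq : ((√3 : ℝ) : ℂ) ^ 2 = 3 := by
    rw [← Complex.ofReal_pow, Real.sq_sqrt (by norm_num)]
    norm_num
  have : ((√3 : ℝ) : ℂ) ≠ 0 := by simp
  field_simp
  rw [hsq]

/-! ### The Mellin transform of the densities -/

/-- The common form of the three densities, with `z = 4 x / 27`: the pair of terms
`(1 ± √(1 - z)) ^ A z ^ B / (k π √(3 (1 - z)))`, where the one with the minus sign is rewritten by
means of `1 - √(1 - z) = z / (1 + √(1 - z))`. -/
noncomputable def density (k A B x : ℝ) : ℝ :=
  (1 + √(1 - 4 * x / 27)) ^ A / (k * Real.pi * √(3 * (1 - 4 * x / 27))) * (4 * x / 27) ^ B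
    + (1 + √(1 - 4 * x / 27)) ^ (-A) / (k * Real.pi * √(3 * (1 - 4 * x / 27)))
      * (4 * x / 27) ^ (A + B)

/-- `density` on `(0, 27/4)`, extended by zero and regarded as a complex function, so that its Mellin
transform is an integral over the support only. -/
noncomputable def densityExt (k A B : ℝ) : ℝ → ℂ :=
  (Ioo 0 (27 / 4)).indicator fun x => (density k A B x : ℂ)

/-- Under `x = 27 v (1 - v)` with `0 < v < 1/2` one has `√(1 - z) = 1 - 2 v`. The factor
`dx = 27 (1 - 2 v) dv` cancels the singularity at `z = 1`, and the two terms of the density are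
exchanged by `v ↦ 1 - v`. -/
theorem density_comp_mul_deriv (k A B : ℝ) {v : ℝ} (hv : v ∈ Ioo (0 : ℝ) (1 / 2)) :
    27 * (1 - 2 * v) * density k A B (27 * (v * (1 - v))) =
      27 * 2 ^ (A + 2 * B) / (k * Real.pi * √3) *
        (v ^ B * (1 - v) ^ (A + B) + v ^ (A + B) * (1 - v) ^ B) := by
  obtain ⟨h0, h1⟩ := hv
  have hw : 0 < 1 - v := by linarith
  have hd : 0 < 1 - 2 * v := by linarith
  have hz : 4 * (27 * (v * (1 - v))) / 27 = 2 * v * (2 * (1 - v)) := by ring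
  have hsq : 1 - 2 * v * (2 * (1 - v)) = (1 - 2 * v) ^ 2 := by ring
  have h3 : √(3 * (1 - 2 * v) ^ 2) = √3 * (1 - 2 * v) := by
    rw [Real.sqrt_mul (by norm_num), Real.sqrt_sq hd.le]
  rw [density, hz, hsq, h3, Real.sqrt_sq hd.le,
    show 1 + (1 - 2 * v) = 2 * (1 - v) by ring]
  have h2 : (2 : ℝ) ^ (A + 2 * B) = 2 ^ A * 2 ^ B * 2 ^ B := by
    rw [two_mul, ← add_assoc, Real.rpow_add two_pos, Real.rpow_add two_pos]
  have hpow : ∀ {a b : ℝ}, 0 < a → 0 < b → ∀ e : ℝ, (2 * a * (2 * b)) ^ e =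
      2 ^ e * a ^ e * (2 ^ e * b ^ e) := fun {a b} ha hb e => by
    rw [Real.mul_rpow (by positivity) (by positivity), Real.mul_rpow zero_le_two ha.le,
      Real.mul_rpow zero_le_two hb.le]
  rw [hpow h0 hw, hpow h0 hw, Real.mul_rpow zero_le_two hw.le, Real.mul_rpow zero_le_two hw.le, h2]
  simp only [Real.rpow_add two_pos, Real.rpow_add h0, Real.rpow_add hw, Real.rpow_neg hw.le,
    Real.rpow_neg zero_le_two]
  have := (Real.rpow_pos_of_pos hw A).ne'
  have := (Real.rpow_pos_of_pos two_pos A).ne'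
  field_simp

theorem image_mul_one_sub_Ioo :
    (fun v : ℝ => 27 * (v * (1 - v))) '' Ioo 0 (1 / 2) = Ioo 0 (27 / 4) := by
  ext x
  constructor
  · rintro ⟨v, ⟨h0, h1⟩, rfl⟩
    constructor
    · have : 0 < 1 - v := by linarith
      positivity
    · have : 0 < (1 - 2 * v) ^ 2 := by
        have : 0 < 1 - 2 * v := by linarith
        positivity
      simp only
      nlinarith
  · rintro ⟨h0, h1⟩
    have hs : 0 < √(1 - 4 * x / 27) := Real.sqrt_pos.2 (by linarith)
    have hs1 : √(1 - 4 * x / 27) < 1 := by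
      rw [Real.sqrt_lt' one_pos]
      linarith
    -- The smaller root of `27 v (1 - v) = x`.
    refine ⟨(1 - √(1 - 4 * x / 27)) / 2, ⟨by linarith, by linarith⟩, ?_⟩
    have := Real.sq_sqrt (show 0 ≤ 1 - 4 * x / 27 by linarith)
    simp only
    linear_combination (-27 / 4) * this

theorem injOn_mul_one_sub_Ioo :
    InjOn (fun v : ℝ => 27 * (v * (1 - v))) (Ioo 0 (1 / 2)) := by
  rintro v ⟨_, h1⟩ w ⟨_, h2⟩ h
  have h3 : (v - w) * (1 - v - w) = 0 := by
    dsimp only at h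
    linear_combination h / 27
  rcases mul_eq_zero.1 h3 with h4 | h4 <;> linarith

theorem hasDerivAt_mul_one_sub (v : ℝ) :
    HasDerivAt (fun v : ℝ => 27 * (v * (1 - v))) (27 * (1 - 2 * v)) v := by
  have h := ((hasDerivAt_id v).mul ((hasDerivAt_id v).const_sub 1)).const_mul 27
  exact h.congr_deriv (by simp; ring)

theorem mellin_density_integrand_comp (k A B : ℝ) (s : ℂ) {v : ℝ}
    (hv : v ∈ Ioo (0 : ℝ) (1 / 2)) :
    |27 * (1 - 2 * v)| • (((27 * (v * (1 - v)) : ℝ) : ℂ) ^ (s - 1) •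
        (density k A B (27 * (v * (1 - v))) : ℂ)) =
      ((27 * 2 ^ (A + 2 * B) / (k * Real.pi * √3) : ℝ) : ℂ) * 27 ^ (s - 1) *
        ((v : ℂ) ^ (s + B - 1) * (1 - (v : ℂ)) ^ (s + A + B - 1) +
          ((1 - v : ℝ) : ℂ) ^ (s + B - 1) * (1 - ((1 - v : ℝ) : ℂ)) ^ (s + A + B - 1)) := by
  have hd : 0 < 27 * (1 - 2 * v) := by linarith [hv.2]
  have h0 := hv.1
  have hw : 0 < 1 - v := by linarith [hv.2]
  have hvC : (v : ℂ) ≠ 0 := Complex.ofReal_ne_zero.2 h0.ne'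
  have hwC : ((1 - v : ℝ) : ℂ) ≠ 0 := Complex.ofReal_ne_zero.2 hw.ne'
  have key := congrArg (fun y : ℝ => (y : ℂ)) (density_comp_mul_deriv k A B hv)
  rw [abs_of_pos hd, Complex.real_smul, smul_eq_mul, mul_left_comm, ← Complex.ofReal_mul, key,
    Complex.ofReal_mul 27, Complex.mul_cpow_ofReal_nonneg (by norm_num) (by positivity),
    Complex.ofReal_mul v, Complex.mul_cpow_ofReal_nonneg h0.le hw.le,
    Complex.ofReal_mul, Complex.ofReal_add, Complex.ofReal_mul, Complex.ofReal_mul,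
    Complex.ofReal_cpow h0.le, Complex.ofReal_cpow h0.le, Complex.ofReal_cpow hw.le,
    Complex.ofReal_cpow hw.le]
  have e1 : (1 : ℂ) - (v : ℂ) = ((1 - v : ℝ) : ℂ) := by push_cast; ring
  have e2 : (1 : ℂ) - ((1 - v : ℝ) : ℂ) = (v : ℂ) := by push_cast; ring
  rw [e2, e1, show s + B - 1 = (s - 1) + B by ring,
    show s + A + B - 1 = (s - 1) + ((A + B : ℝ) : ℂ) by push_cast; ring,
    Complex.cpow_add _ _ hvC, Complex.cpow_add _ _ hvC, Complex.cpow_add _ _ hwC,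
    Complex.cpow_add _ _ hwC]
  push_cast
  ring

/-- The Mellin transform of the density is a complete Beta integral: its two terms give the
halves over `(0, 1/2)` and `(1/2, 1)` of one and the same integrand. -/
theorem hasMellin_densityExt {k A B : ℝ} {s : ℂ} (hB : 0 < (s + B).re)
    (hAB : 0 < (s + A + B).re) :
    HasMellin (densityExt k A B) s
      (((27 * 2 ^ (A + 2 * B) / (k * Real.pi * √3) : ℝ) : ℂ) * 27 ^ (s - 1) *
        Complex.betaIntegral (s + B) (s + A + B)) := by
  set c : ℂ := ((27 * 2 ^ (A + 2 * B) / (k * Real.pi * √3) : ℝ) : ℂ) * 27 ^ (s - 1) with hc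
  set Φ : ℝ → ℂ := fun v => (v : ℂ) ^ (s + B - 1) * (1 - (v : ℂ)) ^ (s + A + B - 1) with hΦ
  have hΦi : IntervalIntegrable Φ volume 0 1 := Complex.betaIntegral_convergent hB hAB
  have hΦ1 : IntervalIntegrable Φ volume 0 (1 / 2) :=
    hΦi.mono_set (uIcc_subset_uIcc_left (by rw [uIcc_of_le zero_le_one]; norm_num))
  have hΦ2 : IntervalIntegrable Φ volume (1 / 2) 1 :=
    hΦi.mono_set (uIcc_subset_uIcc_right (by rw [uIcc_of_le zero_le_one]; norm_num))
  have hΦ3 : IntervalIntegrable (fun v => Φ (1 - v)) volume 0 (1 / 2) := by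
    have := (hΦ2.comp_sub_left 1).symm
    norm_num at this
    simpa using this
  have hsum : ∫ v in (0 : ℝ)..(1 / 2), (Φ v + Φ (1 - v)) =
      Complex.betaIntegral (s + B) (s + A + B) := by
    rw [intervalIntegral.integral_add hΦ1 hΦ3, intervalIntegral.integral_comp_sub_left Φ 1,
      show (1 : ℝ) - 1 / 2 = 1 / 2 by norm_num, sub_zero,
      intervalIntegral.integral_add_adjacent_intervals hΦ1 hΦ2]
    rfl
  have hind : (fun x : ℝ => (x : ℂ) ^ (s - 1) • densityExt k A B x) =
      (Ioo 0 (27 / 4)).indicator fun x : ℝ => (x : ℂ) ^ (s - 1) • (density k A B x : ℂ) := by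
    funext x
    by_cases hx : x ∈ Ioo (0 : ℝ) (27 / 4) <;> simp [densityExt, hx]
  have hsub : Ioi (0 : ℝ) ∩ Ioo 0 (27 / 4) = Ioo 0 (27 / 4) :=
    inter_eq_right.2 fun x hx => hx.1
  have hder : ∀ v ∈ Ioo (0 : ℝ) (1 / 2), HasDerivWithinAt (fun v : ℝ => 27 * (v * (1 - v)))
      (27 * (1 - 2 * v)) (Ioo 0 (1 / 2)) v := fun v _ =>
    (hasDerivAt_mul_one_sub v).hasDerivWithinAt
  constructor
  · rw [MellinConvergent, hind, IntegrableOn, integrable_indicator_iff measurableSet_Ioo,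
      IntegrableOn, Measure.restrict_restrict measurableSet_Ioo, inter_comm, hsub,
      ← IntegrableOn, ← image_mul_one_sub_Ioo,
      integrableOn_image_iff_integrableOn_abs_deriv_smul measurableSet_Ioo hder
        injOn_mul_one_sub_Ioo]
    refine IntegrableOn.congr_fun ?_
      (fun v hv => (mellin_density_integrand_comp k A B s hv).symm) measurableSet_Ioo
    have := ((intervalIntegrable_iff_integrableOn_Ioo_of_le (by norm_num)).1
      (hΦ1.add hΦ3)).const_mul c
    exact this
  · rw [mellin, hind, setIntegral_indicator measurableSet_Ioo, hsub, ← image_mul_one_sub_Ioo,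
      integral_image_eq_integral_abs_deriv_smul measurableSet_Ioo hder injOn_mul_one_sub_Ioo,
      setIntegral_congr_fun measurableSet_Ioo
        (fun v hv => mellin_density_integrand_comp k A B s hv), integral_const_mul, ← hsum,
      intervalIntegral.integral_of_le (by norm_num), integral_Ioc_eq_integral_Ioo]

/-- The Beta integral is a quotient of Gamma values, and the hypothesis `hΓ` holds when
`s, s + B, s + A + B` are, in some order, the arguments in the triplication formula for
`Γ (3 s + r - 2)`, the numerator of `psi 3 r s`. -/
theorem hasMellin_densityExt_psi {k A B r : ℝ} {s : ℂ} (hA : A + 2 * B = r - 1)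
    (hk : k = 2 ^ r * 3 ^ (2 - r)) (hB : 0 < (s + B).re) (hAB : 0 < (s + A + B).re)
    (hs : 0 < s.re) (hw : 0 < (s + (r - 2) / 3).re)
    (hΓ : Complex.Gamma s * Complex.Gamma (s + B) * Complex.Gamma (s + A + B) =
      Complex.Gamma (s + (r - 2) / 3) * Complex.Gamma (s + (r - 2) / 3 + 1 / 3) *
        Complex.Gamma (s + (r - 2) / 3 + 2 / 3)) :
    HasMellin (densityExt k A B) s (psi 3 r s) := by
  have h := hasMellin_densityExt (k := k) hB hAB
  refine ⟨h.1, h.2.trans ?_⟩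
  have hbeta := Complex.Gamma_mul_Gamma_eq_betaIntegral hB hAB
  have hAC : (A : ℂ) + 2 * B = r - 1 := by exact_mod_cast hA
  have hsum : s + B + (s + A + B) = 2 * s + r - 1 := by linear_combination hAC
  have hΓsum : Complex.Gamma (2 * s + r - 1) ≠ 0 := by
    rw [← hsum]
    exact Complex.Gamma_ne_zero_of_re_pos (by rw [Complex.add_re]; exact add_pos hB hAB)
  have hΓs := Complex.Gamma_ne_zero_of_re_pos hs
  have htrip := Gamma_mul_Gamma_add_third_mul_Gamma_add_two_thirds hw
  rw [← hΓ, mul_assoc, hbeta, hsum] at htrip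
  have hpsi : psi 3 r s = Complex.Gamma (3 * (s + (r - 2) / 3)) /
      (Complex.Gamma s * Complex.Gamma (2 * s + r - 1)) := by
    rw [psi]
    push_cast
    ring_nf
  have h27 : (27 : ℂ) ≠ 0 := by norm_num
  have hconst : ((27 * 2 ^ (A + 2 * B) / (k * Real.pi * √3) : ℝ) : ℂ) * 27 ^ (s - 1) *
      (2 * Real.pi * (√3 : ℝ) * (27 : ℂ) ^ (-(s + (r - 2) / 3))) = 1 := by
    have e1 : (27 : ℂ) ^ (s - 1) * (27 : ℂ) ^ (-(s + (r - 2) / 3)) =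
        (((27 : ℝ) ^ (-1 - (r - 2) / 3) : ℝ) : ℂ) := by
      rw [← Complex.cpow_add _ _ h27, Complex.ofReal_cpow (by norm_num)]
      push_cast
      ring_nf
    have e2 : (27 : ℝ) ^ (-1 - (r - 2) / 3) = 3 ^ (2 - r) / 27 := by
      rw [show (27 : ℝ) = 3 ^ (3 : ℝ) by norm_num, ← Real.rpow_mul (by norm_num),
        ← Real.rpow_sub (by norm_num)]
      ring_nf
    rw [show ∀ a b c d e f : ℂ, a * b * (c * d * e * f) = a * (c * d * e) * (b * f) by
      intros; ring, e1, e2, hA, hk, Real.rpow_sub_one two_ne_zero]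
    have : (0 : ℝ) < 2 ^ r := by positivity
    have : (0 : ℝ) < 3 ^ (2 - r) := by positivity
    have hpi := Real.pi_pos
    norm_cast
    field_simp
  rw [hpsi, eq_div_iff (mul_ne_zero hΓs hΓsum)]
  calc _ = (((27 * 2 ^ (A + 2 * B) / (k * Real.pi * √3) : ℝ) : ℂ) * 27 ^ (s - 1)) *
        (Complex.Gamma s * (Complex.Gamma (2 * s + r - 1) *
          Complex.betaIntegral (s + B) (s + A + B))) := by ring
    _ = _ := by
      rw [htrip, ← mul_assoc, hconst, one_mul]

/-! ### Determinacy of the moment problem -/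

theorem integral_abs_pow_le {μ : Measure ℝ} [IsProbabilityMeasure μ] {n : ℕ}
    (hn : Integrable (fun x : ℝ => x ^ n) μ) (h2n : Integrable (fun x : ℝ => x ^ (2 * n)) μ) :
    ∫ x, |x ^ n| ∂μ ≤ 1 + ∫ x, x ^ (2 * n) ∂μ := by
  have h : ∫ x, |x ^ n| ∂μ ≤ ∫ x, (1 + x ^ (2 * n)) ∂μ := by
    refine integral_mono hn.abs ((integrable_const 1).add h2n) fun x => ?_
    have h1 : x ^ (2 * n) = |x ^ n| ^ 2 := by rw [sq_abs, ← pow_mul, mul_comm]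
    simp only [h1]
    -- `y ≤ 1 + y ^ 2` for `y = |x ^ n|`.
    nlinarith [sq_nonneg (|x ^ n| - 1), abs_nonneg (x ^ n)]
  rwa [integral_add (integrable_const 1) h2n, integral_const, probReal_univ, one_smul] at h

/-- Geometrically bounded moments make the Taylor series of the characteristic function converge
everywhere. Absolute moments are controlled by `|x| ^ n ≤ 1 + x ^ (2 n)`. -/
theorem hasSum_charFun_of_moments {μ : Measure ℝ} [IsProbabilityMeasure μ] {m : ℕ → ℝ} {K R : ℝ}
    (hbound : ∀ n, |m n| ≤ K * R ^ n)
    (hμ : ∀ n : ℕ, Integrable (fun x : ℝ => x ^ n) μ ∧ ∫ x, x ^ n ∂μ = m n) (t : ℝ) :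
    HasSum (fun n : ℕ => (t * Complex.I) ^ n / n.factorial * m n) (charFun μ t) := by
  set F : ℕ → ℝ → ℂ := fun n x => (t * Complex.I) ^ n / n.factorial * ((x ^ n : ℝ) : ℂ) with hF
  have hFi : ∀ n, Integrable (F n) μ := fun n => (hμ n).1.ofReal.const_mul _
  have hnorm : ∀ n, ∫ x, ‖F n x‖ ∂μ ≤
      |t| ^ n / n.factorial + K * ((|t| * R ^ 2) ^ n / n.factorial) := by
    intro n
    have h1 : ∀ x, ‖F n x‖ = |t| ^ n / n.factorial * |x ^ n| := fun x => by simp [hF]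
    simp only [h1]
    rw [integral_const_mul]
    have h2 := integral_abs_pow_le (hμ n).1 (hμ (2 * n)).1
    rw [(hμ (2 * n)).2] at h2
    have h3 := (le_abs_self _).trans (hbound (2 * n))
    calc |t| ^ n / n.factorial * ∫ x, |x ^ n| ∂μ
        ≤ |t| ^ n / n.factorial * (1 + K * R ^ (2 * n)) := by
          gcongr
          linarith
      _ = _ := by
          rw [mul_pow, pow_mul]
          ring
  have hsum : Summable fun n => ∫ x, ‖F n x‖ ∂μ :=
    Summable.of_nonneg_of_le (fun n => integral_nonneg fun x => norm_nonneg _) hnorm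
      ((Real.summable_pow_div_factorial _).add ((Real.summable_pow_div_factorial _).mul_left K))
  have h := hasSum_integral_of_summable_integral_norm hFi hsum
  have hexp : ∀ x, ∑' n, F n x = Complex.exp (t * x * Complex.I) := by
    intro x
    rw [Complex.exp_eq_exp_ℂ, NormedSpace.exp_eq_tsum_div]
    refine tsum_congr fun n => ?_
    simp only [hF]
    push_cast
    ring
  simp only [hexp, ← charFun_apply_real] at h
  refine h.congr_fun fun n => ?_
  simp only [hF]
  rw [integral_const_mul, integral_complex_ofReal, (hμ n).2]

/-- A probability measure on the line with geometrically bounded moments is determined by them; no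
assumption on the support is needed. -/
theorem measure_eq_of_moments {μ ν : Measure ℝ} [IsProbabilityMeasure μ] [IsProbabilityMeasure ν]
    {m : ℕ → ℝ} {K R : ℝ} (hbound : ∀ n, |m n| ≤ K * R ^ n)
    (hμ : ∀ n : ℕ, Integrable (fun x : ℝ => x ^ n) μ ∧ ∫ x, x ^ n ∂μ = m n)
    (hν : ∀ n : ℕ, Integrable (fun x : ℝ => x ^ n) ν ∧ ∫ x, x ^ n ∂ν = m n) : μ = ν :=
  Measure.ext_of_charFun <| funext fun t =>
    (hasSum_charFun_of_moments hbound hμ t).unique (hasSum_charFun_of_moments hbound hν t)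

/-! ### Binomial moments and the densities -/

theorem psi_three_natCast (r n : ℕ) : psi 3 r (n + 1) = ((3 * n + r).choose n : ℂ) := by
  have h1 : ((n + 1 : ℂ) - 1) * (3 : ℝ) + (r : ℝ) + 1 = ((3 * n + r : ℕ) : ℂ) + 1 := by
    push_cast
    ring
  have h2 : ((n + 1 : ℂ) - 1) * ((3 : ℝ) - 1) + (r : ℝ) + 1 = ((2 * n + r : ℕ) : ℂ) + 1 := by
    push_cast
    ring
  rw [psi, h1, h2, Complex.Gamma_nat_eq_factorial, Complex.Gamma_nat_eq_factorial,
    Complex.Gamma_nat_eq_factorial, show 3 * n + r = n + (2 * n + r) by ring, Nat.cast_add_choose]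

theorem ring_choose_three (r n : ℕ) :
    Ring.choose ((n : ℝ) * 3 + r) n = ((3 * n + r).choose n : ℝ) := by
  rw [← Ring.choose_natCast]
  push_cast
  ring_nf

theorem choose_three_mul_add_le (r n : ℕ) : |((3 * n + r).choose n : ℝ)| ≤ 2 ^ r * 8 ^ n := by
  rw [Nat.abs_cast]
  have h : (3 * n + r).choose n ≤ 2 ^ (3 * n + r) := Nat.choose_le_two_pow _ _
  have h2 : 2 ^ (3 * n + r) = 2 ^ r * 8 ^ n := by
    rw [pow_add, pow_mul, mul_comm]
    norm_num
  rw [h2] at h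
  exact_mod_cast h

theorem HasInverseMellinAt.congr {F G : ℂ → ℂ} {d x : ℝ} {v : ℂ}
    (h : ∀ t : ℝ, F (d + t * Complex.I) = G (d + t * Complex.I))
    (hF : HasInverseMellinAt F d x v) : HasInverseMellinAt G d x v := by
  simpa only [HasInverseMellinAt, h] using hF

theorem density_nonneg {k : ℝ} (hk : 0 < k) (A B : ℝ) {x : ℝ} (hx : x ∈ Ioo (0 : ℝ) (27 / 4)) :
    0 ≤ density k A B x := by
  have := hx.1
  have := Real.pi_pos
  unfold density
  positivity

theorem measurable_density (k A B : ℝ) : Measurable (density k A B) := by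
  unfold density
  fun_prop

theorem differentiableAt_density {k : ℝ} (hk : 0 < k) (A B : ℝ) {x : ℝ}
    (hx : x ∈ Ioo (0 : ℝ) (27 / 4)) : DifferentiableAt ℝ (density k A B) x := by
  obtain ⟨h0, h1⟩ := hx
  have hz : 4 * x / 27 ≠ 0 := by positivity
  have hy : 0 < 1 - 4 * x / 27 := by linarith
  have hs : 0 < √(1 - 4 * x / 27) := Real.sqrt_pos.2 hy
  have hd : k * Real.pi * √(3 * (1 - 4 * x / 27)) ≠ 0 := by
    have := Real.pi_pos
    positivity
  have h1s : 1 + √(1 - 4 * x / 27) ≠ 0 := by positivity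
  have dz : DifferentiableAt ℝ (fun x : ℝ => 4 * x / 27) x := by fun_prop
  have dy : DifferentiableAt ℝ (fun x : ℝ => 1 - 4 * x / 27) x := by fun_prop
  have ds : DifferentiableAt ℝ (fun x : ℝ => 1 + √(1 - 4 * x / 27)) x :=
    (dy.sqrt hy.ne').const_add 1
  have dd : DifferentiableAt ℝ (fun x : ℝ => k * Real.pi * √(3 * (1 - 4 * x / 27))) x :=
    ((dy.const_mul 3).sqrt (by positivity)).const_mul _
  exact (((ds.rpow_const (Or.inl h1s)).div dd hd).mul (dz.rpow_const (Or.inl hz))).add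
    (((ds.rpow_const (Or.inl h1s)).div dd hd).mul (dz.rpow_const (Or.inl hz)))

theorem cEnd_three : cEnd 3 = 27 / 4 := by
  rw [cEnd, show (1 : ℝ) - 3 = -(2 : ℕ) by norm_num, Real.rpow_neg (by norm_num),
    Real.rpow_natCast, show (3 : ℝ) ^ (3 : ℝ) = 3 ^ (3 : ℕ) by exact_mod_cast Real.rpow_natCast 3 3]
  norm_num

theorem densityExt_of_mem {k A B x : ℝ} (hx : x ∈ Ioo (0 : ℝ) (27 / 4)) :
    densityExt k A B x = density k A B x :=
  indicator_of_mem hx _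

theorem differentiableAt_densityExt {k : ℝ} (hk : 0 < k) (A B : ℝ) {x : ℝ}
    (hx : x ∈ Ioo (0 : ℝ) (27 / 4)) : DifferentiableAt ℝ (densityExt k A B) x := by
  have h : DifferentiableAt ℝ (fun x => (density k A B x : ℂ)) x :=
    Complex.ofRealCLM.differentiableAt.comp x (differentiableAt_density hk A B hx)
  refine h.congr_of_eventuallyEq ?_
  filter_upwards [isOpen_Ioo.mem_nhds hx] with y hy using densityExt_of_mem hy

/-- The `n`-th moment is the value of the Mellin transform at `n + 1`. -/
theorem moment_density {k A B : ℝ} {n : ℕ} {c : ℝ}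
    (h : HasMellin (densityExt k A B) (n + 1) (c : ℂ)) :
    IntegrableOn (fun x => x ^ n * density k A B x) (Ioo 0 (27 / 4)) ∧
      ∫ x in Ioo 0 (27 / 4), x ^ n * density k A B x = c := by
  have hind : (fun x : ℝ => (x : ℂ) ^ ((n + 1 : ℂ) - 1) • densityExt k A B x) =
      (Ioo 0 (27 / 4)).indicator fun x : ℝ => ((x ^ n * density k A B x : ℝ) : ℂ) := by
    funext x
    by_cases hx : x ∈ Ioo (0 : ℝ) (27 / 4) <;> simp [densityExt, hx]
  have hsub : Ioi (0 : ℝ) ∩ Ioo 0 (27 / 4) = Ioo 0 (27 / 4) :=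
    inter_eq_right.2 fun x hx => hx.1
  obtain ⟨h1, h2⟩ := h
  constructor
  · rw [MellinConvergent, hind, IntegrableOn, integrable_indicator_iff measurableSet_Ioo,
      IntegrableOn, Measure.restrict_restrict measurableSet_Ioo, inter_comm, hsub] at h1
    rw [IntegrableOn]
    simpa only [RCLike.re_eq_complex_re, Complex.ofReal_re] using h1.re
  · rw [mellin, hind, setIntegral_indicator measurableSet_Ioo, hsub,
      integral_complex_ofReal] at h2
    exact_mod_cast h2

/-- Inversion of the Mellin transform gives the integral representation, its values at the positive
integers give the moments. -/
theorem isV_density {k A B : ℝ} {r : ℕ} (hk : 0 < k)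
    (h : ∀ s : ℂ, 1 - (1 + (r : ℝ)) / 3 < s.re →
      HasMellin (densityExt k A B) s (psi 3 r s)) : IsV 3 r (density k A B) := by
  have hmom : ∀ n : ℕ, IntegrableOn (fun x => x ^ n * density k A B x) (Ioo 0 (27 / 4)) ∧
      ∫ x in Ioo 0 (27 / 4), x ^ n * density k A B x = ((3 * n + r).choose n : ℝ) := by
    intro n
    refine moment_density ?_
    have := h (n + 1) (by
      have : (0 : ℝ) ≤ r := r.cast_nonneg
      have : (0 : ℝ) ≤ n := n.cast_nonneg
      simp
      linarith)
    rw [psi_three_natCast] at this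
    exact_mod_cast this
  rw [IsV, IsInverseMellinOfPsi, IsDensityOfNu, cEnd_three]
  refine ⟨fun x hx d hd => ?_, fun x hx => density_nonneg hk A B hx,
    (measurable_density k A B).aemeasurable, ?_⟩
  · rw [← densityExt_of_mem hx]
    refine HasInverseMellinAt.congr (fun t => (h _ (by simpa using hd)).2)
      (hasInverseMellinAt_mellin hx.1 (h d (by simpa using hd)).1
        (differentiableAt_densityExt hk A B hx))
  · set ν : Measure ℝ := (volume.restrict (Ioo 0 (27 / 4))).withDensity
      (fun x => ENNReal.ofReal (density k A B x)) with hν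
    have hmeas : Measurable fun x => ENNReal.ofReal (density k A B x) :=
      (measurable_density k A B).ennreal_ofReal
    have hae : ∀ n : ℕ, (fun x => x ^ n * density k A B x)
        =ᵐ[volume.restrict (Ioo 0 (27 / 4))]
        fun x => (ENNReal.ofReal (density k A B x)).toReal • x ^ n := fun n => by
      filter_upwards [ae_restrict_mem measurableSet_Ioo] with x hx
      rw [ENNReal.toReal_ofReal (density_nonneg hk A B hx), smul_eq_mul, mul_comm]
    have hνmom : ∀ n : ℕ, Integrable (fun x : ℝ => x ^ n) ν ∧
        ∫ x, x ^ n ∂ν = ((3 * n + r).choose n : ℝ) := by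
      intro n
      constructor
      · rw [hν, integrable_withDensity_iff_integrable_smul' hmeas
          (ae_of_all _ fun x => ENNReal.ofReal_lt_top)]
        exact (hmom n).1.congr (hae n)
      · rw [hν, integral_withDensity_eq_integral_toReal_smul hmeas
          (ae_of_all _ fun x => ENNReal.ofReal_lt_top), ← integral_congr_ae (hae n), (hmom n).2]
    have hprob : IsProbabilityMeasure ν := by
      constructor
      have h1 := (hmom 0).2
      have hi := (hmom 0).1
      simp only [pow_zero, one_mul, Nat.choose_zero_right, Nat.cast_one] at h1 hi
      rw [hν, withDensity_apply _ MeasurableSet.univ, Measure.restrict_univ,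
        ← ofReal_integral_eq_lintegral_ofReal hi, h1, ENNReal.ofReal_one]
      filter_upwards [ae_restrict_mem measurableSet_Ioo] with x hx using density_nonneg hk A B hx
    refine ⟨ν, ⟨hprob, fun n => ?_⟩, fun ν' hν' => ?_, rfl⟩
    · rw [ring_choose_three]
      exact hνmom n
    · have := hν'.1
      refine measure_eq_of_moments (choose_three_mul_add_le r) (fun n => ?_) hνmom
      rw [← ring_choose_three]
      exact hν'.2 n

theorem theorem5p1 :
    cEnd 3 = 27 / 4 ∧
    ∀ z : ℝ → ℝ, (∀ x, z x = 4 * x / 27) →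
      IsV 3 0 (fun x =>
        (1 + √(1 - z x)) ^ (1 / 3 : ℝ) / (9 * Real.pi * √(3 * (1 - z x))) * z x ^ (-2 / 3 : ℝ)
        + (1 + √(1 - z x)) ^ (-1 / 3 : ℝ) / (9 * Real.pi * √(3 * (1 - z x)))
          * z x ^ (-1 / 3 : ℝ)) ∧
      IsV 3 1 (fun x =>
        (1 + √(1 - z x)) ^ (2 / 3 : ℝ) / (6 * Real.pi * √(3 * (1 - z x))) * z x ^ (-1 / 3 : ℝ)
        + (1 + √(1 - z x)) ^ (-2 / 3 : ℝ) / (6 * Real.pi * √(3 * (1 - z x)))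
          * z x ^ (1 / 3 : ℝ)) ∧
      IsV 3 2 (fun x =>
        (1 + √(1 - z x)) ^ (1 / 3 : ℝ) / (4 * Real.pi * √(3 * (1 - z x))) * z x ^ (1 / 3 : ℝ)
        + (1 + √(1 - z x)) ^ (-1 / 3 : ℝ) / (4 * Real.pi * √(3 * (1 - z x)))
          * z x ^ (2 / 3 : ℝ)) := by
  refine ⟨cEnd_three, fun z hz => ⟨?_, ?_, ?_⟩⟩
  · have h := isV_density (k := 9) (A := 1 / 3) (B := -2 / 3) (r := 0) (by norm_num)
      fun s hs => by
        norm_num at hs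
        refine hasMellin_densityExt_psi (by norm_num) (by norm_num) ?_ ?_ ?_ ?_ ?_
        iterate 4 ((try simp); linarith)
        push_cast
        ring_nf
    convert h using 1
    · norm_num
    · funext x
      rw [density, hz]
      norm_num
  · have h := isV_density (k := 6) (A := 2 / 3) (B := -1 / 3) (r := 1) (by norm_num)
      fun s hs => by
        norm_num at hs
        refine hasMellin_densityExt_psi (by norm_num) (by norm_num) ?_ ?_ ?_ ?_ ?_
        iterate 4 ((try simp); linarith)
        push_cast
        ring_nf
    convert h using 1
    · norm_num
    · funext x
      rw [density, hz]
      norm_num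
  · have h := isV_density (k := 4) (A := 1 / 3) (B := 1 / 3) (r := 2) (by norm_num)
      fun s hs => by
        norm_num at hs
        refine hasMellin_densityExt_psi (by norm_num) (by norm_num) ?_ ?_ ?_ ?_ ?_
        iterate 4 ((try simp); linarith)
        push_cast
        ring_nf
    convert h using 1
    · norm_num
    · funext x
      rw [density, hz]
      norm_num
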